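/- **Setting.** Let $d,k,n$ be natural numbers with $2k\le n$. For a permutation $\sigma\in S(n)$ let $V_\sigma$ be the operator on $(\mathbb C^d)^{\otimes n}$ permuting the tensor factors, $V_\sigma|x_1\cdots x_n\rangle=|x_{\sigma^{-1}(1)}\cdots x_{\sigma^{-1}(n)}\rangle$; for $l\le n$ the group $S(l)\subseteq S(n)$ permutes the first $l$ factors. Let $V_{a,b}$ be the swap of the factors $a,b$, let $t_b$ denote partial transposition on the factor $b$ (in the standard basis), and put $$V^{(k)}=V^{t_n}_{n-2k+1,n}\,V^{t_{n-1}}_{n-2k+2,n-1}\cdots V^{t_{n-k+1}}_{n-k,n-k+1}.$$ For Young diagrams $\mu\vdash l$ and $\alpha\vdash l'$, $l'\le l$, a path $r_{\mu/\alpha}$ is a chain of Young diagrams from $\mu$ to $\alpha$ in which each step removes one box. A basis index $i_\mu$ is a path from $\mu$ to the empty diagram; for each $l'\le l$ it is written uniquely as $i_\mu=(r_{\mu/\alpha},l_\alpha)$ with $\alpha\vdash l'$ and $l_\alpha$ a basis index of $\alpha$. A Kronecker delta of two paths is $1$ if they are the same path (in particular have the same end diagrams) and $0$ otherwise. Let $(\phi^\mu)$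 be any family of unitary irreducible matrix representations, one for each Young diagram $\mu\vdash l$ and each $l\ge 0$, $\phi^\mu$ being a representation of $S(l)$ with rows and columns indexed by the basis indices of $\mu$, such that distinct diagrams with the same number of boxes label inequivalent irreps and such that all $\phi^\mu$ are in partially reduced (PRIR) form: for $l'\le l$, $\mu\vdash l$ and $\varkappa\in S(l')\subseteq S(l)$, $$\phi^\mu_{(r_{\mu/\alpha},i_\alpha)\,(\tilde r_{\mu/\beta},j_\beta)}(\varkappa)=\delta^{r_{\mu/\alpha}\tilde r_{\mu/\beta}}\,\phi^\alpha_{i_\alpha j_\alpha}(\varkappa)\qquad(\alpha,\beta\vdash l').$$ Let $d_\mu$ be the dimension of $\phi^\mu$, and for $\mu\vdash l$ let $m_\mu$ be the multiplicity of $\phi^\mu$ in the representation $\sigma\mapsto V_\sigma$ of $S(l)$ on $(\mathbb C^d)^{\otimes l}$ (the Schur–Weyl multiplicity). For $\mu\vdash l\le n$ put $$E^\mu_{ij}=\frac{d_\mu}{l!}\sum_{\tau\in S(l)}\phi^\mu_{ji}(\tau^{-1})\,V_\tau$$ as an operator on $(\mathbb C^d)^{\otimes n}$. For $\alpha\vdash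 n-2k$, $\mu,\nu\vdash n-k$, paths $r_{\mu/\alpha},r_{\nu/\alpha}$, and a fixed basis index $1_\alpha$ of $\alpha$, put $$F^{r_{\mu/\alpha}r_{\nu/\alpha}}_{i_\mu\ j_\nu}=\frac{m_\alpha}{\sqrt{m_\mu m_\nu}}\;E^\mu_{i_\mu\,(r_{\mu/\alpha},1_\alpha)}\;V^{(k)}\;E^\nu_{(r_{\nu/\alpha},1_\alpha)\,j_\nu},$$ and define the matrix elements of an operator $X$ in the operator basis $F$ by $$(X)^{r_{\mu/\alpha}r_{\nu/\alpha}}_{i_\mu\ j_\nu}=\frac1{m_\alpha}\operatorname{tr}\!\left[X\,F^{r_{\mu/\alpha}r_{\nu/\alpha}}_{i_\mu\ j_\nu}\right].$$ (If $m_\mu=0$ or $m_\nu=0$, i.e. if one of the irreps does not occur, division by $0$ is read as $0$, so that $F=0$, and both sides below vanish.) **Claim.** For all $\alpha,\mu,\nu,r_{\mu/\alpha},r_{\nu/\alpha}$ as above: 1. for $i_\mu=(r_{\mu/\beta},k_\beta)$ and $j_\nu=(r_{\nu/\gamma},l_\gamma)$ with $\beta,\gamma\vdash n-2k$, $$\bigl(V^{(k)}\bigr)^{r_{\mu/\alpha}r_{\nu/\alpha}}_{(r_{\mu/\beta},k_\beta)\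 (r_{\nu/\gamma},l_\gamma)}=\delta_{k_\beta l_\gamma}\,\delta^{r_{\mu/\alpha}r_{\mu/\beta}}\,\delta^{r_{\nu/\alpha}r_{\nu/\gamma}}\,\frac{\sqrt{m_\mu m_\nu}}{m_\alpha};$$ 2. for every $\tau\in S(n-k)$ and all $i_\mu,j_\nu$, $$\bigl(V_\tau\bigr)^{r_{\mu/\alpha}r_{\nu/\alpha}}_{i_\mu\ j_\nu}=\delta^{r_{\mu/\alpha}r_{\nu/\alpha}}\sqrt{\frac{m_\mu}{m_\nu}}\sum_{k_\mu}\delta_{k_\mu j_\nu}\,\phi^\mu_{k_\mu i_\mu}(\tau),$$ that is, for $m_\mu,m_\nu>0$, it is $\phi^\mu_{j_\mu i_\mu}(\tau)$ if $r_{\mu/\alpha}=r_{\nu/\alpha}$ (so $\mu=\nu$), and $0$ otherwise. -/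

import Mathlib

namespace PartialTransposeAlgebra

noncomputable section

/-! ### Young diagrams and paths in Young's lattice -/

/-- Young diagrams with `n` boxes. -/
abbrev Diagram (n : ℕ) : Type := {μ : YoungDiagram // μ.card = n}

/-- Downward paths in Young's lattice from the second diagram to the first one:
`YPath α μ` is the set of all chains from `μ` down to `α` in which each step removes one box. -/
inductive YPath (α : YoungDiagram) : YoungDiagram → Type
  | nil : YPath α α
  | cons {ν μ : YoungDiagram} (r : YPath α ν) (hle : ν ≤ μ) (hcard : μ.card = ν.card + 1) :
      YPath α μ

/-- Concatenation `(r_{μ/α}, l)`: follow `r` from `μ` down to `α`, and then `l` from `α` down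
to `β`. -/
def YPath.append {α β : YoungDiagram} : {μ : YoungDiagram} → YPath α μ → YPath β α → YPath β μ
  | _, .nil, l => l
  | _, .cons r hle hcard, l => .cons (r.append l) hle hcard

/-- The index set of the basis of the irrep `μ`: all paths in Young's lattice from `μ` down to the
empty diagram (equivalently, standard Young tableaux of shape `μ`). -/
abbrev Idx (μ : YoungDiagram) : Type := YPath ⊥ μ

/-- The basis index `i_μ = (r_{μ/α}, l_α)`. -/
abbrev idx {α μ : YoungDiagram} (r : YPath α μ) (l : Idx α) : Idx μ := r.append l

theorem finite_idx (μ : YoungDiagram) : Finite (Idx μ) := by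
  induction hn : μ.card using Nat.strong_induction_on generalizing μ with
  | _ n ih =>
    have hfin : Finite {ν : YoungDiagram // ν ≤ μ ∧ μ.card = ν.card + 1} := by
      refine Finite.of_injective
        (fun ν => (⟨ν.1.cells, Finset.mem_powerset.2 (fun x hx => ν.2.1 hx)⟩ :
          {s // s ∈ μ.cells.powerset})) ?_
      intro a b h
      exact Subtype.ext (YoungDiagram.ext (congrArg Subtype.val h))
    have hfin' : ∀ ν : {ν : YoungDiagram // ν ≤ μ ∧ μ.card = ν.card + 1}, Finite (Idx ν.1) :=
      fun ν => ih ν.1.card (by have := ν.2.2; omega) ν.1 rfl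
    refine Finite.of_surjective
      (α := PLift (⊥ = μ) ⊕ (Σ ν : {ν : YoungDiagram // ν ≤ μ ∧ μ.card = ν.card + 1}, Idx ν.1))
      (fun s => match s with
        | .inl h => h.down ▸ YPath.nil
        | .inr p => YPath.cons p.2 p.1.2.1 p.1.2.2) ?_
    intro p
    cases p with
    | nil => exact ⟨.inl ⟨rfl⟩, rfl⟩
    | cons r h1 h2 => exact ⟨.inr ⟨⟨_, h1, h2⟩, r⟩, rfl⟩

instance (μ : YoungDiagram) : Fintype (Idx μ) := @Fintype.ofFinite _ (finite_idx μ)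

instance (μ : YoungDiagram) : DecidableEq (Idx μ) := Classical.decEq _

open Classical in
/-- Kronecker delta of two paths `r_{μ/α}` and `s_{ν/β}`: it is `1` if the two paths coincide
(in particular `μ = ν` and `α = β`), and `0` otherwise. -/
def pathDelta {α β μ ν : YoungDiagram} (r : YPath α μ) (s : YPath β ν) : ℂ :=
  if (⟨(α, μ), r⟩ : Σ p : YoungDiagram × YoungDiagram, YPath p.1 p.2) = ⟨(β, ν), s⟩ then 1 else 0

/-! ### Irreducible representations of the symmetric groups in PRIR form -/

/-- The representation on column vectors given by a matrix representation. -/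
def matRep {G ι : Type*} [Group G] [Fintype ι] [DecidableEq ι] (M : G →* Matrix ι ι ℂ) :
    Representation ℂ G (ι → ℂ) :=
  (Matrix.toLinAlgEquiv' : Matrix ι ι ℂ ≃ₐ[ℂ] _).toAlgHom.toMonoidHom.comp M

/-- The embedding `S(l) ⊆ S(n)`, where `S(l)` permutes the first `l` points. -/
def extendPerm {l n : ℕ} (h : l ≤ n) (τ : Equiv.Perm (Fin l)) : Equiv.Perm (Fin n) :=
  τ.viaEmbedding (Fin.castLEEmb h)

/-- A choice, for every Young diagram `μ` with `n` boxes and every `n`, of a unitary matrix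
representation of `S(n)`, with rows and columns indexed by the paths from `μ` to the empty
diagram. -/
abbrev RepFamily : Type :=
  (n : ℕ) → (μ : Diagram n) → Equiv.Perm (Fin n) →* Matrix.unitaryGroup (Idx μ.1) ℂ

/-- The matrix-valued homomorphism underlying `φ^μ`. -/
def RepFamily.mat (φ : RepFamily) {n : ℕ} (μ : Diagram n) :
    Equiv.Perm (Fin n) →* Matrix (Idx μ.1) (Idx μ.1) ℂ :=
  (Submonoid.subtype _).comp (φ n μ)

/-- The family `φ` consists of the (unitary) irreps of the symmetric groups, labelled by Young
diagrams, in partially reduced (PRIR) form. -/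
structure IsPRIR (φ : RepFamily) : Prop where
  /-- every `φ^μ` is irreducible -/
  irreducible : ∀ (n : ℕ) (μ : Diagram n), (matRep (φ.mat μ)).IsIrreducible
  /-- different diagrams label inequivalent irreps -/
  inequivalent : ∀ (n : ℕ) (μ ν : Diagram n),
    Nonempty ((matRep (φ.mat μ)).Equiv (matRep (φ.mat ν))) → μ = ν
  /-- `φ^μ` restricted to `S(l)` is block diagonal, with one block for each path `r_{μ/α}`, and
  this block is `φ^α`: the diagonal blocks -/
  restrict_same : ∀ (l n : ℕ) (h : l ≤ n) (μ : Diagram n) (α : Diagram l) (r : YPath α.1 μ.1)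
    (κ : Equiv.Perm (Fin l)) (i j : Idx α.1),
    φ.mat μ (extendPerm h κ) (idx r i) (idx r j) = φ.mat α κ i j
  /-- the off-diagonal blocks -/
  restrict_ne : ∀ (l n : ℕ) (h : l ≤ n) (μ : Diagram n) (α β : Diagram l) (r : YPath α.1 μ.1)
    (s : YPath β.1 μ.1), pathDelta r s = 0 →
    ∀ (κ : Equiv.Perm (Fin l)) (i : Idx α.1) (j : Idx β.1),
      φ.mat μ (extendPerm h κ) (idx r i) (idx s j) = 0

/-! ### Operators on `(ℂ^d)^{⊗ n}` -/

/-- Operators on `(ℂ^d)^{⊗ n}`, as matrices in the product basis `|x_1 ⋯ x_n⟩`. -/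
abbrev Op (d n : ℕ) : Type := Matrix (Fin n → Fin d) (Fin n → Fin d) ℂ

/-- The permutation operators
`V_σ |x_1 ⋯ x_n⟩ = |x_{σ⁻¹(1)} ⋯ x_{σ⁻¹(n)}⟩`. -/
def permOp (d n : ℕ) : Equiv.Perm (Fin n) →* Op d n where
  toFun σ := Matrix.of fun x y => if x = y ∘ ⇑σ⁻¹ then 1 else 0
  map_one' := by
    ext x y
    simp [Matrix.one_apply]
  map_mul' σ τ := by
    ext x y
    simp [Matrix.mul_apply, Function.comp_assoc, Equiv.Perm.coe_mul]

/-- Partial transposition with respect to the system `s`. -/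
def partialTranspose {d n : ℕ} (s : Fin n) (A : Op d n) : Op d n :=
  Matrix.of fun x y => A (Function.update x s (y s)) (Function.update y s (x s))

/-- `V^{(k)} = V_{n-2k+1,n}^{t_n} V_{n-2k+2,n-1}^{t_{n-1}} ⋯ V_{n-k,n-k+1}^{t_{n-k+1}}`,
where `n = m + 2k`. With systems numbered from `0`, the factor number `j < k` is the partially
transposed swap of the systems `m + j` and `n - 1 - j`. -/
def Vk (d m k : ℕ) : Op d (m + k + k) :=
  (List.ofFn fun j : Fin k =>
    partialTranspose (⟨m + k + k - 1 - j, by omega⟩ : Fin (m + k + k))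
      (permOp d (m + k + k)
        (Equiv.swap ⟨m + j, by omega⟩ ⟨m + k + k - 1 - j, by omega⟩))).prod

/-- The multiplicity `m_μ` of the irrep `φ^μ` of `S(n)` in `(ℂ^d)^{⊗ n}`. -/
def mult (φ : RepFamily) (d : ℕ) {n : ℕ} (μ : Diagram n) : ℕ :=
  Module.finrank ℂ (Representation.IntertwiningMap (matRep (φ.mat μ)) (matRep (permOp d n)))

/-- The operators `E_{ij}^μ = (d_μ / l!) ∑_{τ ∈ S(l)} φ^μ_{ji}(τ⁻¹) V_τ`, for `μ` with `l` boxes,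
acting on the first `l` of `n` systems (and as the identity on the others). -/
def opE (φ : RepFamily) (d : ℕ) {l n : ℕ} (h : l ≤ n) (μ : Diagram l) (i j : Idx μ.1) : Op d n :=
  ((Fintype.card (Idx μ.1) : ℂ) / (l.factorial : ℂ)) •
    ∑ τ : Equiv.Perm (Fin l), φ.mat μ τ⁻¹ j i • permOp d n (extendPerm h τ)

/-- The operators
`F^{r_{μ/α} r_{ν/α}}_{i_μ j_ν} = m_α / √(m_μ m_ν) · E_{i_μ 1_α}^{r_{μ/α}} V^{(k)} E_{1_α j_ν}^{r_{ν/α}}`,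
where `e` is the distinguished basis index `1_α` of the irrep `α`. -/
def opF (φ : RepFamily) (d : ℕ) {m k : ℕ} {α : Diagram m} {μ ν : Diagram (m + k)} (e : Idx α.1)
    (r : YPath α.1 μ.1) (r' : YPath α.1 ν.1) (i : Idx μ.1) (j : Idx ν.1) : Op d (m + k + k) :=
  (((mult φ d α : ℝ) / √((mult φ d μ : ℝ) * (mult φ d ν : ℝ)) : ℝ) : ℂ) •
    (opE φ d (Nat.le_add_right _ _) μ i (idx r e) * Vk d m k *
      opE φ d (Nat.le_add_right _ _) ν (idx r' e) j)

/-- The matrix element of `X` in the operator basis `F`: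
`(X)^{r_{μ/α} r_{ν/α}}_{i_μ j_ν} = (1 / m_α) tr [X F^{r_{μ/α} r_{ν/α}}_{i_μ j_ν}]`. -/
def matrixElement (φ : RepFamily) (d : ℕ) {m k : ℕ} {α : Diagram m} {μ ν : Diagram (m + k)}
    (e : Idx α.1) (X : Op d (m + k + k)) (r : YPath α.1 μ.1) (r' : YPath α.1 ν.1)
    (i : Idx μ.1) (j : Idx ν.1) : ℂ :=
  (1 / (mult φ d α : ℂ)) * (X * opF φ d e r r' i j).trace

end

end PartialTransposeAlgebra

open PartialTransposeAlgebra

/-!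
The operators `E^μ_{ij}` are matrix units, and `tr (E^μ_{ij} V_σ) = m_μ φ^μ_{ji}(σ)`. Since
`V_σᴴ = V_{σ⁻¹}`, the trace form is nondegenerate on the span of the permutation operators, so an
element `X` of this span is determined by the numbers `tr (X V_σ)`. The partial trace over the last
`k` of `m + k` systems maps the span of the `V_σ`, `σ ∈ S(m + k)`, into that of the `V_κ`,
`κ ∈ S(m)`, and the PRIR form of `φ^μ` gives the numbers `tr (Tr_k(E^μ_{ij}) V_κ)`; comparison with
`tr (E^α_{pq} V_κ)` shows
`Tr_k E^μ_{(r_{μ/α},p) (s_{μ/β},q)} = δ^{r_{μ/α} s_{μ/β}} (m_μ / m_α) E^α_{pq}`.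

The operator `V^(k)` is, up to normalization, the projection onto a maximally entangled state of the
systems `m + 1, …, m + k` with the last `k` systems, whence for operators `A` on the first `m + k`
systems `V^(k) (A ⊗ 1) V^(k) = (Tr_k A ⊗ 1) V^(k)` and `tr (V^(k) (A ⊗ 1)) = tr A`. These identities
reduce the traces in both matrix elements to traces of products of matrix units.
-/

namespace PartialTransposeAlgebra

open Matrix

section MatrixRepresentations

variable {G ι κ A : Type*} [Group G] [Fintype ι] [DecidableEq ι] [Fintype κ] [DecidableEq κ]
  [Ring A] [Algebra ℂ A]

/-- The intertwining map `v ↦ X *ᵥ v` of the representations on column vectors that is given by a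
matrix `X` intertwining two matrix representations. -/
noncomputable def intertwiner {M : G →* Matrix ι ι ℂ} {N : G →* Matrix κ κ ℂ} (X : Matrix ι κ ℂ)
    (hX : ∀ g, M g * X = X * N g) : Representation.IntertwiningMap (matRep N) (matRep M) where
  toLinearMap := X.mulVecLin
  isIntertwining' g := LinearMap.ext fun v => by
    change X *ᵥ (N g *ᵥ v) = M g *ᵥ (X *ᵥ v)
    rw [mulVec_mulVec, mulVec_mulVec, hX]

theorem eq_zero_of_intertwines {M : G →* Matrix ι ι ℂ} {N : G →* Matrix κ κ ℂ}
    (hM : (matRep M).IsIrreducible) (hN : (matRep N).IsIrreducible)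
    (hNM : IsEmpty ((matRep N).Equiv (matRep M))) {X : Matrix ι κ ℂ}
    (hX : ∀ g, M g * X = X * N g) : X = 0 := by
  have h : intertwiner X hX = 0 := Subsingleton.elim _ _
  exact Matrix.toLin'.injective ((congrArg (·.toLinearMap) h).trans (map_zero _).symm)

theorem exists_eq_smul_one_of_intertwines {M : G →* Matrix ι ι ℂ}
    (hM : (matRep M).IsIrreducible) {X : Matrix ι ι ℂ} (hX : ∀ g, M g * X = X * M g) :
    ∃ c : ℂ, X = c • 1 := by
  obtain ⟨c, hc⟩ :=
    (Representation.IsIrreducible.algebraMap_intertwiningMap_bijective_of_isAlgClosed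
      (ρ := matRep M)).2 (intertwiner X hX)
  have h : c • LinearMap.id = X.mulVecLin := congrArg (·.toLinearMap) hc
  refine ⟨c, Matrix.toLin'.injective ?_⟩
  rw [map_smul, Matrix.toLin'_one, h, Matrix.toLin'_apply']

open scoped ComplexOrder in
theorem eq_zero_of_forall_trace_mul_rep_eq_zero {V : G →* Matrix κ κ ℂ}
    (hV : ∀ g, (V g)ᴴ = V g⁻¹) {X : Matrix κ κ ℂ} (hX : X ∈ Submodule.span ℂ (Set.range V))
    (h : ∀ g, (X * V g).trace = 0) : X = 0 := by
  suffices h' : ∀ Y ∈ Submodule.span ℂ (Set.range V), (X * Yᴴ).trace = 0 from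
    trace_mul_conjTranspose_self_eq_zero_iff.1 (h' X hX)
  intro Y hY
  induction hY using Submodule.span_induction with
  | mem _ hY =>
    obtain ⟨g, rfl⟩ := hY
    rw [hV, h]
  | zero => simp
  | add Y Z _ _ hY hZ => simp [Matrix.mul_add, hY, hZ]
  | smul c Y _ hY => simp [hY]

variable [Fintype G]

theorem mul_sum_conj_eq_sum_conj_mul (M : G →* Matrix ι ι ℂ) (N : G →* Matrix κ κ ℂ)
    (X : Matrix ι κ ℂ) (g : G) :
    M g * ∑ h, M h * X * N h⁻¹ = (∑ h, M h * X * N h⁻¹) * N g := by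
  rw [Matrix.mul_sum, Matrix.sum_mul]
  refine Fintype.sum_equiv (Equiv.mulLeft g) _ _ fun h => ?_
  have hNg : N (h⁻¹ * g⁻¹) * N g = N h⁻¹ := by rw [← map_mul, inv_mul_cancel_right]
  simp only [Equiv.coe_mulLeft, map_mul M, _root_.mul_inv_rev, Matrix.mul_assoc, hNg]

theorem sum_conj_eq_zero {M : G →* Matrix ι ι ℂ} {N : G →* Matrix κ κ ℂ}
    (hM : (matRep M).IsIrreducible) (hN : (matRep N).IsIrreducible)
    (hNM : IsEmpty ((matRep N).Equiv (matRep M))) (X : Matrix ι κ ℂ) :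
    ∑ g, M g * X * N g⁻¹ = 0 :=
  eq_zero_of_intertwines hM hN hNM (mul_sum_conj_eq_sum_conj_mul M N X)

theorem card_smul_sum_conj_eq_trace_smul_one {M : G →* Matrix ι ι ℂ}
    (hM : (matRep M).IsIrreducible) (X : Matrix ι ι ℂ) :
    (Fintype.card ι : ℂ) • ∑ g, M g * X * M g⁻¹ = ((Fintype.card G : ℂ) * X.trace) • 1 := by
  obtain ⟨c, hc⟩ := exists_eq_smul_one_of_intertwines hM (mul_sum_conj_eq_sum_conj_mul M M X)
  have htr : (Fintype.card G : ℂ) * X.trace = c * Fintype.card ι := by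
    have h := congrArg trace hc
    have hconj (g : G) : (M g * X * M g⁻¹).trace = X.trace := by
      rw [trace_mul_comm, ← Matrix.mul_assoc, ← map_mul, inv_mul_cancel, map_one, one_mul]
    simpa [trace_sum, hconj] using h
  rw [hc, smul_smul, htr, mul_comm]

/-- The matrix units `E_{ij} = (dim M / |G|) ∑_g M(g⁻¹)_{ji} V(g)` of the irrep `M` in the algebra
spanned by a representation `V`. -/
noncomputable def matUnit (M : G →* Matrix ι ι ℂ) (V : G →* A) (i j : ι) : A :=
  ((Fintype.card ι : ℂ) / Fintype.card G) • ∑ g, M g⁻¹ j i • V g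

theorem matUnit_apply (M : G →* Matrix ι ι ℂ) (N : G →* Matrix κ κ ℂ) (i j : ι) (a b : κ) :
    matUnit M N i j a b = (Fintype.card ι : ℂ) / Fintype.card G *
      (∑ g, N g * single b j (1 : ℂ) * M g⁻¹) a i := by
  simp [matUnit, Matrix.sum_apply, Matrix.mul_apply, single_apply, mul_comm, ite_and]

theorem matUnit_self {M : G →* Matrix ι ι ℂ} (hM : (matRep M).IsIrreducible) (i j : ι) :
    matUnit M M i j = single i j 1 := by
  have hG : (Fintype.card G : ℂ) ≠ 0 := Nat.cast_ne_zero.2 Fintype.card_ne_zero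
  ext a b
  have h := congrFun₂ (card_smul_sum_conj_eq_trace_smul_one hM (single b j 1)) a i
  rw [Matrix.smul_apply, Matrix.smul_apply, smul_eq_mul, smul_eq_mul] at h
  rw [matUnit_apply, div_mul_eq_mul_div, h, mul_assoc, mul_div_cancel_left₀ _ hG]
  by_cases hbj : b = j
  · simp [hbj, single_apply, one_apply, eq_comm]
  · simp [hbj, Ne.symm hbj, trace_single_eq_of_ne]

theorem matUnit_eq_zero {M : G →* Matrix ι ι ℂ} {N : G →* Matrix κ κ ℂ}
    (hM : (matRep M).IsIrreducible) (hN : (matRep N).IsIrreducible)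
    (hMN : IsEmpty ((matRep M).Equiv (matRep N))) (i j : ι) : matUnit M N i j = 0 := by
  ext a b
  rw [matUnit_apply, sum_conj_eq_zero hN hM hMN, Matrix.zero_apply, mul_zero, Matrix.zero_apply]

theorem rep_mul_matUnit (M : G →* Matrix ι ι ℂ) (V : G →* A) (g : G) (i j : ι) :
    V g * matUnit M V i j = ∑ k, M g k i • matUnit M V k j := by
  simp only [matUnit, mul_smul_comm, Finset.mul_sum, Finset.smul_sum, smul_smul]
  rw [Finset.sum_comm]
  refine Fintype.sum_equiv (Equiv.mulLeft g) _ _ fun h => ?_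
  have hM : M h⁻¹ = M (g * h)⁻¹ * M g := by rw [← map_mul]; simp
  rw [← Finset.sum_smul, ← map_mul, hM, Matrix.mul_apply, Finset.mul_sum]
  exact congrArg (· • _) (Finset.sum_congr rfl fun k _ => by rw [Equiv.coe_mulLeft]; ring)

theorem matUnit_mul_matUnit_eq_sum (M : G →* Matrix ι ι ℂ) (N : G →* Matrix κ κ ℂ) (V : G →* A)
    (i j : ι) (k l : κ) :
    matUnit M V i j * matUnit N V k l = ∑ c, matUnit M N i j c k • matUnit N V c l := by
  have hentry (c : κ) : matUnit M N i j c k =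
      ∑ g, (Fintype.card ι : ℂ) / Fintype.card G * (M g⁻¹ j i * N g c k) := by
    simp [matUnit, Matrix.sum_apply, Finset.mul_sum]
  rw [matUnit, smul_mul_assoc, Finset.sum_mul]
  simp only [smul_mul_assoc, rep_mul_matUnit, hentry, Finset.sum_smul, Finset.smul_sum, smul_smul]
  exact Finset.sum_comm

theorem matUnit_mul_matUnit {M : G →* Matrix ι ι ℂ} (hM : (matRep M).IsIrreducible) (V : G →* A)
    (i j k l : ι) :
    matUnit M V i j * matUnit M V k l = if j = k then matUnit M V i l else 0 := by
  simp [matUnit_mul_matUnit_eq_sum, matUnit_self hM, single_apply, ite_and, ite_smul]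

theorem matUnit_mul_matUnit_eq_zero {M : G →* Matrix ι ι ℂ} {N : G →* Matrix κ κ ℂ}
    (hM : (matRep M).IsIrreducible) (hN : (matRep N).IsIrreducible)
    (hMN : IsEmpty ((matRep M).Equiv (matRep N))) (V : G →* A) (i j : ι) (k l : κ) :
    matUnit M V i j * matUnit N V k l = 0 := by
  simp [matUnit_mul_matUnit_eq_sum, matUnit_eq_zero hM hN hMN]

theorem trace_sum_matUnit_self (M : G →* Matrix ι ι ℂ) (V : G →* Matrix κ κ ℂ) :
    (∑ i, matUnit M V i i).trace = Fintype.card ι *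
      (Module.finrank ℂ (Representation.IntertwiningMap (matRep M) (matRep V)) : ℂ) := by
  have : Invertible (Nat.card G : ℂ) := invertibleOfNonzero (Nat.cast_ne_zero.2 Nat.card_pos.ne')
  have hchar (g : G) : (matRep V).character g * (matRep M).character g⁻¹ =
      (M g⁻¹).trace * (V g).trace :=
    (congrArg₂ (· * ·) (trace_toLin'_eq _) (trace_toLin'_eq _)).trans (mul_comm _ _)
  have hsum : ∑ i, matUnit M V i i =
      ((Fintype.card ι : ℂ) / Fintype.card G) • ∑ g, (M g⁻¹).trace • V g := by
    simp only [matUnit, ← Finset.smul_sum, trace, diag, Finset.sum_smul]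
    rw [Finset.sum_comm]
  rw [hsum, ← Representation.card_inv_mul_sum_char_mul_char_eq_finrank]
  simp only [hchar, trace_smul, trace_sum, smul_eq_mul, Nat.card_eq_fintype_card]
  ring

theorem trace_matUnit {M : G →* Matrix ι ι ℂ} (hM : (matRep M).IsIrreducible)
    (V : G →* Matrix κ κ ℂ) (i j : ι) :
    (matUnit M V i j).trace =
      if i = j then
        (Module.finrank ℂ (Representation.IntertwiningMap (matRep M) (matRep V)) : ℂ)
      else 0 := by
  have hcomm (a b c : ι) : (matUnit M V a b).trace =
      (if a = b then (matUnit M V c c).trace else 0) := by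
    have hab : matUnit M V a c * matUnit M V c b = matUnit M V a b := by
      rw [matUnit_mul_matUnit hM, if_pos rfl]
    rw [← hab, trace_mul_comm, matUnit_mul_matUnit hM]
    by_cases h : a = b
    · simp [h]
    · simp [h, Ne.symm h]
  have : Nonempty ι := ⟨i⟩
  have hι : (Fintype.card ι : ℂ) ≠ 0 := Nat.cast_ne_zero.2 Fintype.card_ne_zero
  have htr := trace_sum_matUnit_self M V
  rw [trace_sum, Finset.sum_congr rfl fun a _ => (hcomm a a i).trans (if_pos rfl),
    Finset.sum_const, Finset.card_univ, nsmul_eq_mul] at htr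
  rw [hcomm i j i, mul_left_cancel₀ hι htr]

theorem trace_matUnit_mul_rep {M : G →* Matrix ι ι ℂ} (hM : (matRep M).IsIrreducible)
    (V : G →* Matrix κ κ ℂ) (i j : ι) (g : G) :
    (matUnit M V i j * V g).trace =
      M g j i * Module.finrank ℂ (Representation.IntertwiningMap (matRep M) (matRep V)) := by
  simp [trace_mul_comm _ (V g), rep_mul_matUnit, trace_sum, trace_matUnit hM]

end MatrixRepresentations

section PartialTrace

variable {d N k : ℕ}

/-- The operator `A ⊗ 1`, which acts as `A` on the first `N` of `N + k` systems. -/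
noncomputable def extendOp (k : ℕ) : Op d N →ₐ[ℂ] Op d (N + k) :=
  (reindexAlgEquiv ℂ ℂ (Fin.appendEquiv N k)).toAlgHom.comp
    ((kroneckerAlgEquiv (Fin N → Fin d) (Fin k → Fin d) ℂ).toAlgHom.comp
      Algebra.TensorProduct.includeLeft)

theorem extendOp_append (A : Op d N) (a a' : Fin N → Fin d) (b b' : Fin k → Fin d) :
    extendOp k A (Fin.append a b) (Fin.append a' b') = if b = b' then A a a' else 0 := by
  have h (a : Fin N → Fin d) (b : Fin k → Fin d) :
      (Fin.appendEquiv N k).symm (Fin.append a b) = (a, b) :=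
    (Fin.appendEquiv N k).symm_apply_apply (a, b)
  simp [extendOp, h, one_apply]

theorem append_eq_append_iff {a a' : Fin N → Fin d} {b b' : Fin k → Fin d} :
    Fin.append a b = Fin.append a' b' ↔ a = a' ∧ b = b' :=
  ((Fin.appendEquiv N k).injective.eq_iff (a := (a, b)) (b := (a', b'))).trans Prod.mk_inj

theorem op_ext_append {A B : Op d (N + k)}
    (h : ∀ a b a' b', A (Fin.append a b) (Fin.append a' b') =
      B (Fin.append a b) (Fin.append a' b')) : A = B := by
  ext x y
  obtain ⟨⟨a, b⟩, rfl⟩ := (Fin.appendEquiv N k).surjective x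
  obtain ⟨⟨a', b'⟩, rfl⟩ := (Fin.appendEquiv N k).surjective y
  exact h a b a' b'

theorem sum_eq_sum_append {R : Type*} [AddCommMonoid R] (f : (Fin (N + k) → Fin d) → R) :
    ∑ x, f x = ∑ a : Fin N → Fin d, ∑ b : Fin k → Fin d, f (Fin.append a b) := by
  rw [← (Fin.appendEquiv N k).sum_comp, Fintype.sum_prod_type]
  rfl

theorem append_comp_extendPerm (h : N ≤ N + k) (τ : Equiv.Perm (Fin N))
    (a : Fin N → Fin d) (b : Fin k → Fin d) :
    Fin.append a b ∘ ⇑(extendPerm h τ) = Fin.append (a ∘ ⇑τ) b := by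
  funext x
  refine Fin.addCases (fun i => ?_) (fun i => ?_) x
  · have hi : extendPerm h τ (Fin.castAdd k i) = Fin.castAdd k (τ i) :=
      τ.viaEmbedding_apply (Fin.castLEEmb h) i
    simp [hi]
  · have hi : extendPerm h τ (Fin.natAdd N i) = Fin.natAdd N i :=
      τ.viaEmbedding_apply_of_notMem (Fin.castLEEmb h) _ (by
        rintro ⟨j, hj⟩
        exact absurd (congrArg Fin.val hj) (by simp; omega))
    simp [hi]

theorem permOp_apply {n : ℕ} (σ : Equiv.Perm (Fin n)) (x y : Fin n → Fin d) :
    permOp d n σ x y = if x = y ∘ ⇑σ⁻¹ then 1 else 0 := rfl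

theorem conjTranspose_permOp {n : ℕ} (σ : Equiv.Perm (Fin n)) :
    (permOp d n σ)ᴴ = permOp d n σ⁻¹ := by
  ext x y
  simp only [conjTranspose_apply, permOp_apply, inv_inv, apply_ite star, star_one, star_zero]
  refine if_congr ⟨fun h => ?_, fun h => ?_⟩ rfl rfl <;> funext i <;> simp [h]

theorem permOp_extendPerm (h : N ≤ N + k) (τ : Equiv.Perm (Fin N)) :
    permOp d (N + k) (extendPerm h τ) = extendOp k (permOp d N τ) := by
  have hinv : (extendPerm h τ)⁻¹ = extendPerm h τ⁻¹ :=
    (map_inv (Equiv.Perm.viaEmbeddingHom (Fin.castLEEmb h)) τ).symm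
  refine op_ext_append fun a b a' b' => ?_
  rw [extendOp_append, permOp_apply, permOp_apply, hinv, append_comp_extendPerm]
  simp only [append_eq_append_iff, ite_and]
  split_ifs <;> rfl

/-- The partial trace over the last `k` of `N + k` systems. -/
noncomputable def partialTrace (d N k : ℕ) : Op d (N + k) →ₗ[ℂ] Op d N where
  toFun A := of fun a a' => ∑ b, A (Fin.append a b) (Fin.append a' b)
  map_add' A B := by ext; simp [Finset.sum_add_distrib]
  map_smul' c A := by ext; simp [Finset.mul_sum]

theorem partialTrace_apply (A : Op d (N + k)) (a a' : Fin N → Fin d) :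
    partialTrace d N k A a a' = ∑ b, A (Fin.append a b) (Fin.append a' b) := rfl

theorem trace_partialTrace (A : Op d (N + k)) : (partialTrace d N k A).trace = A.trace := by
  simp only [trace, diag, partialTrace_apply, sum_eq_sum_append]

theorem partialTrace_mul_extendOp (A : Op d (N + k)) (B : Op d N) :
    partialTrace d N k (A * extendOp k B) = partialTrace d N k A * B := by
  ext a a'
  simp only [mul_apply, partialTrace_apply, sum_eq_sum_append, extendOp_append, mul_ite, mul_zero,
    Finset.sum_ite_eq', Finset.mem_univ, if_true, Finset.sum_mul]
  exact Finset.sum_comm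

theorem partialTrace_zero (A : Op d (N + 0)) : partialTrace d N 0 A = A := by
  have happ (a : Fin N → Fin d) (b : Fin 0 → Fin d) : Fin.append a b = a := by
    rw [Subsingleton.elim b Fin.elim0, Fin.append_elim0]
    rfl
  ext a a'
  rw [partialTrace_apply, Fintype.sum_unique]
  exact congrArg₂ A (happ a _) (happ a' _)

theorem partialTrace_succ (A : Op d (N + (k + 1))) :
    partialTrace d N (k + 1) A = partialTrace d N k (partialTrace d (N + k) 1 A) := by
  ext a a'
  simp only [partialTrace_apply]
  rw [sum_eq_sum_append]
  have happ (a : Fin N → Fin d) (b : Fin k → Fin d) (c : Fin 1 → Fin d) :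
      Fin.append a (Fin.append b c) = Fin.append (Fin.append a b) c :=
    (Fin.append_assoc a b c).symm ▸ rfl
  exact Finset.sum_congr rfl fun b _ => Finset.sum_congr rfl fun c _ =>
    congrArg₂ A (happ a b c) (happ a' b c)

theorem partialTrace_one_one : partialTrace d N 1 (1 : Op d (N + 1)) = (d : ℂ) • 1 := by
  ext a a'
  simp [partialTrace_apply, one_apply, append_eq_append_iff]

theorem eq_comp_swap_iff {ι R : Type*} [DecidableEq ι] {i j : ι} {x y : ι → R} :
    x = y ∘ Equiv.swap i j ↔
      x i = y j ∧ x j = y i ∧ ∀ l, l ≠ i → l ≠ j → x l = y l := by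
  constructor
  · rintro rfl
    simp +contextual [Equiv.swap_apply_of_ne_of_ne]
  · rintro ⟨hi, hj, h⟩
    funext l
    simp only [Function.comp_apply, Equiv.swap_apply_def]
    split_ifs <;> simp_all

theorem partialTrace_one_swap (i : Fin N) :
    partialTrace d N 1 (permOp d (N + 1) (Equiv.swap (Fin.castAdd 1 i) (Fin.natAdd N 0))) = 1 := by
  have hne (l : Fin N) (l' : Fin 1) : Fin.castAdd 1 l ≠ Fin.natAdd N l' := fun h =>
    absurd (congrArg Fin.val h) (by simp; omega)
  ext a a'
  have h (b : Fin 1 → Fin d) : Fin.append a b = Fin.append a' b ∘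
      ⇑(Equiv.swap (Fin.castAdd 1 i) (Fin.natAdd N (0 : Fin 1)))⁻¹ ↔
        b = (fun _ => a i) ∧ a = a' := by
    rw [Equiv.swap_inv, eq_comp_swap_iff]
    simp only [Fin.append_left, Fin.append_right]
    refine ⟨fun ⟨hi, hi', h⟩ => ⟨?_, funext fun l => ?_⟩, ?_⟩
    · funext l
      rw [Subsingleton.elim l 0, hi]
    · by_cases hl : l = i
      · rw [hl, hi, hi']
      · simpa using h (Fin.castAdd 1 l) (by simpa using hl) (hne l 0)
    · rintro ⟨rfl, rfl⟩
      exact ⟨rfl, rfl, fun l _ _ => Fin.addCases (fun l => by simp) (fun l => by simp) l⟩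
  simp only [partialTrace_apply, permOp_apply, h, one_apply, ite_and, Finset.sum_ite_eq',
    Finset.mem_univ, if_true]

theorem exists_viaEmbedding_eq {α β : Type*} (f : α ↪ β) {σ : Equiv.Perm β}
    (hσ : ∀ b ∉ Set.range f, σ b = b) : ∃ τ : Equiv.Perm α, τ.viaEmbedding f = σ := by
  have hmem (b : β) : σ b ∈ Set.range f ↔ b ∈ Set.range f := by
    refine not_iff_not.1 ⟨fun hb => ?_, fun hb => (hσ b hb).symm ▸ hb⟩
    rwa [σ.injective (hσ _ hb)] at hb
  refine ⟨(Equiv.ofInjective f f.injective).symm.permCongr (σ.subtypePerm hmem),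
    Equiv.ext fun b => ?_⟩
  by_cases hb : b ∈ Set.range f
  · obtain ⟨a, rfl⟩ := hb
    rw [Equiv.Perm.viaEmbedding_apply]
    exact congrArg Subtype.val (Equiv.apply_symm_apply (Equiv.ofInjective f f.injective) _)
  · rw [Equiv.Perm.viaEmbedding_apply_of_notMem _ _ _ hb, hσ b hb]

theorem exists_extendPerm_eq {σ : Equiv.Perm (Fin (N + 1))}
    (hσ : σ (Fin.last N) = Fin.last N) :
    ∃ τ : Equiv.Perm (Fin N), extendPerm (Nat.le_add_right N 1) τ = σ :=
  exists_viaEmbedding_eq _ (Fin.lastCases (fun _ => hσ) fun i h => absurd ⟨i, rfl⟩ h)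

/-- The span of the permutation operators, i.e. the image of the group algebra of `S(n)`. -/
abbrev permSpan (d n : ℕ) : Submodule ℂ (Op d n) := Submodule.span ℂ (Set.range (permOp d n))

theorem permOp_mem_permSpan {n : ℕ} (σ : Equiv.Perm (Fin n)) : permOp d n σ ∈ permSpan d n :=
  Submodule.subset_span ⟨σ, rfl⟩

theorem partialTrace_one_permOp_mem_permSpan (σ : Equiv.Perm (Fin (N + 1))) :
    partialTrace d N 1 (permOp d (N + 1) σ) ∈ permSpan d N := by
  cases hσ : σ (Fin.last N) using Fin.lastCases with
  | last =>
    obtain ⟨τ, rfl⟩ := exists_extendPerm_eq hσ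
    rw [permOp_extendPerm, ← one_mul (extendOp 1 _), partialTrace_mul_extendOp,
      partialTrace_one_one, smul_one_mul]
    exact Submodule.smul_mem _ _ (permOp_mem_permSpan τ)
  | cast i =>
    obtain ⟨τ, hτ⟩ := exists_extendPerm_eq
      (σ := Equiv.swap (Fin.castAdd 1 i) (Fin.natAdd N 0) * σ) (by
        rw [Equiv.Perm.mul_apply, hσ]; exact Equiv.swap_apply_left _ _)
    rw [← Equiv.swap_mul_self_mul (Fin.castAdd 1 i) (Fin.natAdd N 0) σ, ← hτ, map_mul,
      permOp_extendPerm, partialTrace_mul_extendOp, partialTrace_one_swap, one_mul]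
    exact permOp_mem_permSpan τ

theorem partialTrace_mem_permSpan {k : ℕ} {A : Op d (N + k)} (hA : A ∈ permSpan d (N + k)) :
    partialTrace d N k A ∈ permSpan d N := by
  induction k with
  | zero => rwa [partialTrace_zero]
  | succ k ih =>
    rw [partialTrace_succ]
    have hle : permSpan d (N + k + 1) ≤ (permSpan d (N + k)).comap (partialTrace d (N + k) 1) :=
      Submodule.span_le.2 (Set.range_subset_iff.2 partialTrace_one_permOp_mem_permSpan)
    exact ih (hle hA)

end PartialTrace

section PartiallyTransposedSwaps

variable {d n m k : ℕ}

theorem partialTranspose_swap_apply {i j : Fin n} (hij : i ≠ j) (x y : Fin n → Fin d) :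
    partialTranspose j (permOp d n (Equiv.swap i j)) x y =
      if x i = x j ∧ y i = y j ∧ ∀ l, l ≠ i → l ≠ j → x l = y l then 1 else 0 := by
  refine if_congr ?_ rfl rfl
  rw [Equiv.swap_inv, eq_comp_swap_iff]
  simp +contextual [hij, eq_comm (a := y j)]

/-- The condition under which the product of the partially transposed swaps of the disjoint pairs
`f j, g j` has matrix element `1` (and not `0`) between `|x⟩` and `|y⟩`: both are constant on every
pair, and they agree outside of the pairs. -/
abbrev IsPaired {X : Type*} (f g : Fin k → Fin n) (x y : Fin n → X) : Prop :=
  (∀ j, x (f j) = x (g j)) ∧ (∀ j, y (f j) = y (g j)) ∧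
    ∀ l, (∀ j, l ≠ f j ∧ l ≠ g j) → x l = y l

theorem isPaired_succ_iff {X : Type*} {f g : Fin (k + 1) → Fin n} (hf : f.Injective)
    (hg : g.Injective) (hfg : ∀ i j, f i ≠ g j) (x y z : Fin n → X) :
    (x (f 0) = x (g 0) ∧ z (f 0) = z (g 0) ∧ ∀ l, l ≠ f 0 → l ≠ g 0 → x l = z l) ∧
        IsPaired (fun j => f j.succ) (fun j => g j.succ) z y ↔
      z = (fun l => if l = f 0 ∨ l = g 0 then y l else x l) ∧ IsPaired f g x y := by
  have hff (j : Fin k) : f j.succ ≠ f 0 := hf.ne (Fin.succ_ne_zero j)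
  have hgg (j : Fin k) : g j.succ ≠ g 0 := hg.ne (Fin.succ_ne_zero j)
  simp only [IsPaired, Fin.forall_fin_succ, funext_iff]
  constructor
  · rintro ⟨⟨hx₀, hz₀, hxz⟩, hz, hy, hzy⟩
    have hzf : z (f 0) = y (f 0) := hzy _ fun j => ⟨(hff j).symm, hfg _ _⟩
    have hzg : z (g 0) = y (g 0) := hzy _ fun j => ⟨(hfg _ _).symm, (hgg j).symm⟩
    refine ⟨by grind, ⟨hx₀, fun j => ?_⟩, ⟨hzf ▸ hzg ▸ hz₀, hy⟩, fun l hl => ?_⟩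
    · rw [hxz _ (hff j) (hfg _ _), hxz _ (hfg _ _).symm (hgg j), hz]
    · rw [hxz l hl.1.1 hl.1.2, hzy l hl.2]
  · rintro ⟨hz, ⟨hx₀, hx⟩, ⟨hy₀, hy⟩, hxy⟩
    refine ⟨⟨hx₀, by simp [hz, hy₀], fun l hf hg => ?_⟩, fun j => ?_, hy, fun l hl => ?_⟩
    · simp [hz, hf, hg]
    · simp [hz, hff j, hgg j, hfg, (hfg _ _).symm, hx]
    · grind

theorem prod_partialTranspose_swap_apply {f g : Fin k → Fin n} (hf : f.Injective)
    (hg : g.Injective) (hfg : ∀ i j, f i ≠ g j) (x y : Fin n → Fin d) :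
    (List.ofFn fun j => partialTranspose (g j) (permOp d n (Equiv.swap (f j) (g j)))).prod x y =
      if IsPaired f g x y then 1 else 0 := by
  induction k generalizing x y with
  | zero => simp [IsPaired, one_apply, funext_iff]
  | succ k ih =>
    rw [List.ofFn_succ, List.prod_cons, mul_apply]
    simp only [ih (f := fun j => f j.succ) (g := fun j => g j.succ)
      (hf.comp (Fin.succ_injective k)) (hg.comp (Fin.succ_injective k))
      (fun i j => hfg i.succ j.succ), partialTranspose_swap_apply (hfg 0 0), ite_mul, one_mul,
      zero_mul, ← ite_and, isPaired_succ_iff hf hg hfg]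
    simp only [ite_and, Finset.sum_ite_eq', Finset.mem_univ, if_true]

theorem Vk_apply (x y : Fin (m + k + k) → Fin d) : Vk d m k x y =
    if IsPaired (fun j : Fin k => Fin.castAdd k (Fin.natAdd m j))
      (fun j => Fin.natAdd (m + k) j.rev) x y then 1 else 0 := by
  have hpos (j : Fin k) : Fin.natAdd (m + k) j.rev = ⟨m + k + k - 1 - j, by omega⟩ := by
    ext
    simp only [Fin.val_rev, Fin.val_natAdd]
    omega
  rw [← prod_partialTranspose_swap_apply (fun i j h => by simpa using h)
    (fun i j h => by simpa using h) (fun i j h => by simp [Fin.ext_iff] at h; omega)]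
  simp only [hpos]
  rfl

theorem Vk_apply_append (a a' : Fin m → Fin d) (b b' c c' : Fin k → Fin d) :
    Vk d m k (Fin.append (Fin.append a b) c) (Fin.append (Fin.append a' b') c') =
      if c = b ∘ Fin.rev ∧ c' = b' ∘ Fin.rev ∧ a = a' then 1 else 0 := by
  have hrev (b c : Fin k → Fin d) : (∀ j, b j = c j.rev) ↔ c = b ∘ Fin.rev :=
    ⟨fun h => funext fun j => by simp [h], fun h j => by simp [h]⟩
  simp only [Vk_apply, IsPaired, Fin.append_left, Fin.append_right, hrev]
  refine if_congr (and_congr_right fun _ => and_congr_right fun _ =>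
    ⟨fun h => funext fun i => ?_, ?_⟩) rfl rfl
  · simpa using h (Fin.castAdd k (Fin.castAdd k i)) fun j => by
      simp only [ne_eq, Fin.ext_iff, Fin.val_castAdd, Fin.val_natAdd]
      omega
  · rintro rfl
    refine Fin.addCases (Fin.addCases (fun i _ => ?_) (fun j h => ?_)) (fun j h => ?_)
    · exact absurd (by rw [Fin.rev_rev]) (h j.rev).2
    · simp
    · exact absurd rfl (h j).1

theorem comp_rev_inj {b b' : Fin k → Fin d} : b ∘ Fin.rev = b' ∘ Fin.rev ↔ b = b' :=
  Fin.rev_surjective.injective_comp_right.eq_iff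

theorem partialTrace_Vk : partialTrace d (m + k) k (Vk d m k) = 1 := by
  refine op_ext_append fun a b a' b' => ?_
  rw [partialTrace_apply]
  simp only [Vk_apply_append, one_apply, append_eq_append_iff, ite_and, Finset.sum_ite_eq',
    Finset.mem_univ, if_true, comp_rev_inj]
  split_ifs <;> rfl

theorem trace_Vk_mul_extendOp (A : Op d (m + k)) :
    (Vk d m k * extendOp k A).trace = A.trace := by
  rw [← trace_partialTrace, partialTrace_mul_extendOp, partialTrace_Vk, one_mul]

theorem Vk_mul_extendOp_mul_Vk (A : Op d (m + k)) :
    Vk d m k * extendOp k A * Vk d m k =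
      extendOp k (extendOp k (partialTrace d m k A)) * Vk d m k := by
  refine op_ext_append fun ab c ab' c' => ?_
  obtain ⟨⟨a, b⟩, rfl⟩ := (Fin.appendEquiv m k).surjective ab
  obtain ⟨⟨a', b'⟩, rfl⟩ := (Fin.appendEquiv m k).surjective ab'
  have hb (x : Fin k → Fin d) (z : ℂ) :
      (if c = x ∘ Fin.rev then if b = x then z else 0 else 0) =
        if b = x then if c = b ∘ Fin.rev then z else 0 else 0 := by
    split_ifs <;> simp_all
  simp only [Fin.appendEquiv, Equiv.coe_fn_mk, mul_apply, sum_eq_sum_append, Vk_apply_append,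
    extendOp_append, partialTrace_apply, ite_and]
  simp [comp_rev_inj, hb]

theorem trace_Vk_mul_extendOp_mul_Vk_mul_extendOp (A B : Op d (m + k)) :
    (Vk d m k * extendOp k A * Vk d m k * extendOp k B).trace =
      (partialTrace d m k A * partialTrace d m k B).trace := by
  rw [Vk_mul_extendOp_mul_Vk, Matrix.mul_assoc, trace_mul_comm, Matrix.mul_assoc, ← map_mul,
    trace_Vk_mul_extendOp, ← trace_partialTrace, partialTrace_mul_extendOp, trace_mul_comm]

end PartiallyTransposedSwaps

section PRIR

theorem pathDelta_self {α μ : YoungDiagram} (r : YPath α μ) : pathDelta r r = 1 :=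
  if_pos rfl

theorem pathDelta_of_ne {α μ : YoungDiagram} {r s : YPath α μ} (h : r ≠ s) :
    pathDelta r s = 0 :=
  if_neg (by simpa using h)

theorem pathDelta_of_bot_ne {α β μ ν : YoungDiagram} (h : α ≠ β) (r : YPath α μ)
    (s : YPath β ν) : pathDelta r s = 0 :=
  if_neg fun hrs => h (congrArg (fun x => x.1.1) hrs)

theorem pathDelta_of_top_ne {α β μ ν : YoungDiagram} (h : μ ≠ ν) (r : YPath α μ)
    (s : YPath β ν) : pathDelta r s = 0 :=
  if_neg fun hrs => h (congrArg (fun x => x.1.2) hrs)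

theorem pathDelta_comm {α β μ ν : YoungDiagram} (r : YPath α μ) (s : YPath β ν) :
    pathDelta r s = pathDelta s r := by
  classical exact if_congr eq_comm rfl rfl

/-- The operators `E^μ_{ij}` on the systems on which they act non-trivially, i.e. without the
identity on further systems that is built into `opE`. -/
noncomputable def unitE (φ : RepFamily) (d : ℕ) {N : ℕ} (μ : Diagram N) (i j : Idx μ.1) : Op d N :=
  matUnit (φ.mat μ) (permOp d N) i j

variable {φ : RepFamily} {d m k : ℕ}

theorem opE_eq_extendOp {N : ℕ} (h : N ≤ N + k) (μ : Diagram N) (i j : Idx μ.1) :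
    opE φ d h μ i j = extendOp k (unitE φ d μ i j) := by
  simp only [opE, unitE, matUnit, map_smul, map_sum, Fintype.card_perm, Fintype.card_fin,
    permOp_extendPerm]

theorem unitE_mem_permSpan {N : ℕ} (μ : Diagram N) (i j : Idx μ.1) :
    unitE φ d μ i j ∈ permSpan d N :=
  Submodule.smul_mem _ _ (Submodule.sum_mem _ fun _ _ =>
    Submodule.smul_mem _ _ (permOp_mem_permSpan _))

theorem eq_of_forall_trace_mul_permOp_eq {N : ℕ} {A B : Op d N} (hA : A ∈ permSpan d N)
    (hB : B ∈ permSpan d N)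
    (h : ∀ σ, (A * permOp d N σ).trace = (B * permOp d N σ).trace) : A = B :=
  sub_eq_zero.1 <| eq_zero_of_forall_trace_mul_rep_eq_zero conjTranspose_permOp
    (sub_mem hA hB) fun σ => by rw [sub_mul, trace_sub, h, sub_self]

theorem trace_partialTrace_mul_permOp (A : Op d (m + k)) (κ : Equiv.Perm (Fin m)) :
    (partialTrace d m k A * permOp d m κ).trace =
      (A * permOp d (m + k) (extendPerm (Nat.le_add_right m k) κ)).trace := by
  rw [← partialTrace_mul_extendOp, trace_partialTrace, permOp_extendPerm]

namespace IsPRIR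

theorem isEmpty_equiv (hφ : IsPRIR φ) {N : ℕ} {μ ν : Diagram N} (h : μ ≠ ν) :
    IsEmpty ((matRep (φ.mat μ)).Equiv (matRep (φ.mat ν))) :=
  not_nonempty_iff.1 (h ∘ hφ.inequivalent N μ ν)

theorem mat_extendPerm_idx_idx (hφ : IsPRIR φ) {α : Diagram m} {μ : Diagram (m + k)}
    (r s : YPath α.1 μ.1) (κ : Equiv.Perm (Fin m)) (i j : Idx α.1) :
    φ.mat μ (extendPerm (Nat.le_add_right m k) κ) (idx r i) (idx s j) =
      pathDelta r s * φ.mat α κ i j := by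
  rcases eq_or_ne r s with rfl | h
  · rw [hφ.restrict_same, pathDelta_self, one_mul]
  · rw [hφ.restrict_ne _ _ _ _ _ _ _ _ (pathDelta_of_ne h), pathDelta_of_ne h, zero_mul]

theorem unitE_mul_unitE (hφ : IsPRIR φ) {N : ℕ} (μ : Diagram N) (i j l : Idx μ.1) :
    unitE φ d μ i j * unitE φ d μ j l = unitE φ d μ i l :=
  (matUnit_mul_matUnit (hφ.irreducible N μ) _ i j j l).trans (if_pos rfl)

theorem unitE_mul_unitE_eq_zero (hφ : IsPRIR φ) {N : ℕ} {μ ν : Diagram N} {j : Idx μ.1}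
    {l : Idx ν.1} (hjl : pathDelta j l = 0) (i : Idx μ.1) (l' : Idx ν.1) :
    unitE φ d μ i j * unitE φ d ν l l' = 0 := by
  rcases eq_or_ne μ ν with rfl | hμν
  · refine (matUnit_mul_matUnit (hφ.irreducible N μ) _ i j l l').trans (if_neg ?_)
    rintro rfl
    exact one_ne_zero (pathDelta_self j ▸ hjl)
  · exact matUnit_mul_matUnit_eq_zero (hφ.irreducible N μ) (hφ.irreducible N ν)
      (hφ.isEmpty_equiv hμν) _ i j l l'

theorem trace_unitE (hφ : IsPRIR φ) {N : ℕ} (μ : Diagram N) (i j : Idx μ.1) :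
    (unitE φ d μ i j).trace = pathDelta i j * mult φ d μ := by
  rw [unitE, trace_matUnit (hφ.irreducible N μ)]
  rcases eq_or_ne i j with rfl | h
  · rw [if_pos rfl, pathDelta_self, one_mul, mult]
  · rw [if_neg h, pathDelta_of_ne h, zero_mul]

theorem trace_unitE_mul_permOp (hφ : IsPRIR φ) {N : ℕ} (μ : Diagram N) (i j : Idx μ.1)
    (σ : Equiv.Perm (Fin N)) :
    (unitE φ d μ i j * permOp d N σ).trace = φ.mat μ σ j i * mult φ d μ :=
  trace_matUnit_mul_rep (hφ.irreducible N μ) _ i j σ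

theorem trace_partialTrace_unitE_mul_permOp (hφ : IsPRIR φ) {α : Diagram m} {μ : Diagram (m + k)}
    (r s : YPath α.1 μ.1) (p q : Idx α.1) (κ : Equiv.Perm (Fin m)) :
    (partialTrace d m k (unitE φ d μ (idx r p) (idx s q)) * permOp d m κ).trace =
      pathDelta r s * φ.mat α κ q p * mult φ d μ := by
  rw [trace_partialTrace_mul_permOp, hφ.trace_unitE_mul_permOp, hφ.mat_extendPerm_idx_idx,
    pathDelta_comm]

theorem trace_unitE_idx_idx (hφ : IsPRIR φ) {α : Diagram m} {μ : Diagram (m + k)}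
    (r s : YPath α.1 μ.1) (p : Idx α.1) :
    (unitE φ d μ (idx r p) (idx s p)).trace = pathDelta r s * mult φ d μ := by
  simpa [trace_partialTrace] using hφ.trace_partialTrace_unitE_mul_permOp (d := d) r s p p 1

theorem mult_eq_zero (hφ : IsPRIR φ) {α : Diagram m} {μ : Diagram (m + k)} (r : YPath α.1 μ.1)
    (e : Idx α.1) (hα : mult φ d α = 0) : mult φ d μ = 0 := by
  have hE : unitE φ d α e e = 0 :=
    eq_of_forall_trace_mul_permOp_eq (unitE_mem_permSpan α e e) (zero_mem _) fun σ => by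
      simp [hφ.trace_unitE_mul_permOp, hα]
  have htr : (unitE φ d α e e * partialTrace d m k (unitE φ d μ (idx r e) (idx r e))).trace =
      matUnit (φ.mat α) (φ.mat α) e e e e * mult φ d μ := by
    rw [trace_mul_comm, unitE.eq_def φ d α, matUnit, mul_smul_comm, Finset.mul_sum]
    simp only [mul_smul_comm, trace_smul, trace_sum, hφ.trace_partialTrace_unitE_mul_permOp,
      pathDelta_self, one_mul, matUnit, Matrix.smul_apply, Matrix.sum_apply, smul_eq_mul,
      Finset.sum_mul, mul_assoc]
  rw [hE, zero_mul, trace_zero, matUnit_self (hφ.irreducible m α), single_apply_same,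
    one_mul] at htr
  exact_mod_cast htr.symm

theorem partialTrace_unitE (hφ : IsPRIR φ) {α : Diagram m} {μ : Diagram (m + k)}
    (r s : YPath α.1 μ.1) (p q : Idx α.1) :
    partialTrace d m k (unitE φ d μ (idx r p) (idx s q)) =
      (pathDelta r s * (mult φ d μ / mult φ d α)) • unitE φ d α p q := by
  refine eq_of_forall_trace_mul_permOp_eq (partialTrace_mem_permSpan (unitE_mem_permSpan μ _ _))
    (Submodule.smul_mem _ _ (unitE_mem_permSpan α p q)) fun κ => ?_
  have hdiv : (mult φ d μ / mult φ d α * mult φ d α : ℂ) = mult φ d μ :=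
    div_mul_cancel_of_imp fun h => by
      exact_mod_cast hφ.mult_eq_zero r p (by exact_mod_cast h)
  rw [hφ.trace_partialTrace_unitE_mul_permOp, smul_mul_assoc, trace_smul,
    hφ.trace_unitE_mul_permOp, smul_eq_mul]
  linear_combination -pathDelta r s * φ.mat α κ q p * hdiv

theorem partialTrace_unitE_of_ne (hφ : IsPRIR φ) {α β : Diagram m} (h : α ≠ β) {μ : Diagram (m + k)}
    (r : YPath α.1 μ.1) (s : YPath β.1 μ.1) (p : Idx α.1) (q : Idx β.1) :
    partialTrace d m k (unitE φ d μ (idx r p) (idx s q)) = 0 := by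
  refine eq_of_forall_trace_mul_permOp_eq (partialTrace_mem_permSpan (unitE_mem_permSpan μ _ _))
    (zero_mem _) fun κ => ?_
  rw [trace_partialTrace_mul_permOp, hφ.trace_unitE_mul_permOp, hφ.restrict_ne _ _ _ _ _ _ _ _
    (pathDelta_of_bot_ne (Subtype.coe_injective.ne h.symm) s r), zero_mul, zero_mul, trace_zero]

theorem matrixElement_eq (hφ : IsPRIR φ) {α : Diagram m} {μ ν : Diagram (m + k)} (e : Idx α.1)
    (X : Op d (m + k + k)) (r : YPath α.1 μ.1) (r' : YPath α.1 ν.1) (i : Idx μ.1)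
    (j : Idx ν.1) :
    matrixElement φ d e X r r' i j =
      ((√((mult φ d μ : ℝ) * (mult φ d ν : ℝ)))⁻¹ : ℝ) *
        (X * extendOp k (unitE φ d μ i (idx r e)) * Vk d m k *
          extendOp k (unitE φ d ν (idx r' e) j)).trace := by
  have hcoeff : (1 / mult φ d α * (mult φ d α / √((mult φ d μ : ℝ) * mult φ d ν)) : ℝ) =
      (√((mult φ d μ : ℝ) * mult φ d ν))⁻¹ := by
    by_cases hα : mult φ d α = 0
    · simp [hα, hφ.mult_eq_zero r e hα]
    · field_simp
  rw [matrixElement, opF, mul_smul_comm, trace_smul, opE_eq_extendOp, opE_eq_extendOp,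
    smul_eq_mul, ← mul_assoc, ← hcoeff]
  simp only [Matrix.mul_assoc]
  push_cast
  rfl

theorem trace_Vk_mul_unitE_mul_Vk_mul_unitE (hφ : IsPRIR φ) {α β γ : Diagram m}
    {μ ν : Diagram (m + k)}
    (e : Idx α.1) (r : YPath α.1 μ.1) (r' : YPath α.1 ν.1) (s : YPath β.1 μ.1)
    (s' : YPath γ.1 ν.1) (p : Idx β.1) (q : Idx γ.1) :
    (Vk d m k * extendOp k (unitE φ d μ (idx s p) (idx r e)) * Vk d m k *
        extendOp k (unitE φ d ν (idx r' e) (idx s' q))).trace =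
      pathDelta p q * pathDelta r s * pathDelta r' s' *
        (mult φ d μ / mult φ d α * (mult φ d ν / mult φ d α) * mult φ d α) := by
  rw [trace_Vk_mul_extendOp_mul_Vk_mul_extendOp]
  rcases eq_or_ne β α with rfl | hβ
  · rcases eq_or_ne γ β with rfl | hγ
    · rw [hφ.partialTrace_unitE, hφ.partialTrace_unitE, smul_mul_smul_comm, hφ.unitE_mul_unitE,
        trace_smul, hφ.trace_unitE, smul_eq_mul, pathDelta_comm r s]
      ring
    · rw [hφ.partialTrace_unitE_of_ne hγ.symm,
        pathDelta_of_bot_ne (Subtype.coe_injective.ne hγ.symm) r']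
      simp
  · rw [hφ.partialTrace_unitE_of_ne hβ, pathDelta_of_bot_ne (Subtype.coe_injective.ne hβ.symm) r]
    simp

theorem trace_permOp_mul_unitE_mul_Vk_mul_unitE (hφ : IsPRIR φ) {α : Diagram m}
    {μ ν : Diagram (m + k)}
    (e : Idx α.1) (r : YPath α.1 μ.1) (r' : YPath α.1 ν.1) (τ : Equiv.Perm (Fin (m + k)))
    (i : Idx μ.1) (j : Idx ν.1) :
    (extendOp k (permOp d (m + k) τ) * extendOp k (unitE φ d μ i (idx r e)) * Vk d m k *
        extendOp k (unitE φ d ν (idx r' e) j)).trace =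
      pathDelta r r' * (∑ l, pathDelta l j * φ.mat μ τ l i) * mult φ d μ := by
  have htr : (extendOp k (permOp d (m + k) τ) * extendOp k (unitE φ d μ i (idx r e)) * Vk d m k *
      extendOp k (unitE φ d ν (idx r' e) j)).trace =
        (unitE φ d ν (idx r' e) j * (permOp d (m + k) τ * unitE φ d μ i (idx r e))).trace := by
    rw [← map_mul, Matrix.mul_assoc, trace_mul_comm, Matrix.mul_assoc, ← map_mul,
      trace_Vk_mul_extendOp]
  have hτ : permOp d (m + k) τ * unitE φ d μ i (idx r e) =
      ∑ l, φ.mat μ τ l i • unitE φ d μ l (idx r e) := rep_mul_matUnit _ _ τ i _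
  rw [htr, hτ, Finset.mul_sum, trace_sum, Finset.mul_sum, Finset.sum_mul]
  refine Finset.sum_congr rfl fun l _ => ?_
  rw [mul_smul_comm, trace_smul, smul_eq_mul]
  rcases eq_or_ne μ ν with rfl | hμν
  · rcases eq_or_ne l j with rfl | hlj
    · rw [hφ.unitE_mul_unitE, hφ.trace_unitE_idx_idx, pathDelta_self, pathDelta_comm]
      ring
    · rw [hφ.unitE_mul_unitE_eq_zero (pathDelta_of_ne hlj.symm), pathDelta_of_ne hlj]
      simp
  · have hμν' : μ.1 ≠ ν.1 := Subtype.coe_injective.ne hμν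
    rw [hφ.unitE_mul_unitE_eq_zero (pathDelta_of_top_ne hμν'.symm j l),
      pathDelta_of_top_ne hμν' r r']
    simp

theorem matrixElement_Vk (hφ : IsPRIR φ) {α β γ : Diagram m} {μ ν : Diagram (m + k)} (e : Idx α.1)
    (r : YPath α.1 μ.1) (r' : YPath α.1 ν.1) (s : YPath β.1 μ.1) (s' : YPath γ.1 ν.1)
    (p : Idx β.1) (q : Idx γ.1) :
    matrixElement φ d e (Vk d m k) r r' (idx s p) (idx s' q) =
      pathDelta p q * pathDelta r s * pathDelta r' s' *
        ((√((mult φ d μ : ℝ) * (mult φ d ν : ℝ)) / (mult φ d α : ℝ) : ℝ) : ℂ) := by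
  have hcoeff : ((√((mult φ d μ : ℝ) * mult φ d ν))⁻¹ *
      (mult φ d μ / mult φ d α * (mult φ d ν / mult φ d α) * mult φ d α) : ℝ) =
        √((mult φ d μ : ℝ) * mult φ d ν) / mult φ d α := by
    rcases eq_or_ne (mult φ d α : ℝ) 0 with hα | hα
    · simp [hα]
    · conv_rhs => rw [← Real.div_sqrt]
      field_simp
  rw [hφ.matrixElement_eq, hφ.trace_Vk_mul_unitE_mul_Vk_mul_unitE, ← hcoeff]
  push_cast
  ring

theorem matrixElement_permOp (hφ : IsPRIR φ) {α : Diagram m} {μ ν : Diagram (m + k)} (e : Idx α.1)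
    (r : YPath α.1 μ.1) (r' : YPath α.1 ν.1) (τ : Equiv.Perm (Fin (m + k))) (i : Idx μ.1)
    (j : Idx ν.1) :
    matrixElement φ d e (permOp d (m + k + k) (extendPerm (Nat.le_add_right _ _) τ)) r r' i j =
      pathDelta r r' * ((√((mult φ d μ : ℝ) / (mult φ d ν : ℝ)) : ℝ) : ℂ) *
        ∑ l : Idx μ.1, pathDelta l j * φ.mat μ τ l i := by
  rw [hφ.matrixElement_eq, permOp_extendPerm, hφ.trace_permOp_mul_unitE_mul_Vk_mul_unitE]
  rcases eq_or_ne μ ν with rfl | hμν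
  · have hcoeff : ((√((mult φ d μ : ℝ) * mult φ d μ))⁻¹ * mult φ d μ : ℝ) =
        √((mult φ d μ : ℝ) / mult φ d μ) := by
      rw [Real.sqrt_mul_self (Nat.cast_nonneg _)]
      rcases eq_or_ne (mult φ d μ : ℝ) 0 with hμ | hμ <;> simp [hμ]
    rw [← hcoeff]
    push_cast
    ring
  · simp [pathDelta_of_top_ne (Subtype.coe_injective.ne hμν) r r']

end IsPRIR

end PRIR

end PartialTransposeAlgebra

theorem mainTheorem9 (φ : RepFamily)
    (hφ : IsPRIR φ) (d m k : ℕ)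
    (α : Diagram m) (e : Idx α.1)
    (μ ν : Diagram (m + k))
    (r : YPath α.1 μ.1) (r' : YPath α.1 ν.1) :
    (∀ (β γ : Diagram m)
        (s : YPath β.1 μ.1) (s' : YPath γ.1 ν.1)
        (p : Idx β.1) (q : Idx γ.1),
      matrixElement φ d e (Vk d m k) r r'
          (idx s p) (idx s' q) =
        pathDelta p q * pathDelta r s *
          pathDelta r' s' *
          ((√((mult φ d μ : ℝ) * (mult φ d ν : ℝ)) /
            (mult φ d α : ℝ) : ℝ) : ℂ)) ∧
    (∀ (τ : Equiv.Perm (Fin (m + k))) (i : Idx μ.1)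
        (j : Idx ν.1),
      matrixElement φ d e
          (permOp d (m + k + k)
            (extendPerm (Nat.le_add_right _ _) τ)) r r' i j =
        pathDelta r r' *
          ((√((mult φ d μ : ℝ) /
            (mult φ d ν : ℝ)) : ℝ) : ℂ) *
          ∑ l : Idx μ.1,
            pathDelta l j * φ.mat μ τ l i) :=
  ⟨fun _ _ s s' p q => hφ.matrixElement_Vk e r r' s s' p q,
    fun τ i j => hφ.matrixElement_permOp e r r' τ i j⟩
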